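/- **Proposition 2.11.** Notation: $\|\cdot\|$ is the Euclidean norm, $\mathrm{B}_r(\xi)$ and $\bar{\mathrm{B}}_r(\xi)$ are open and closed balls, $\bar\Xi$ and $\partial\Xi$ are the closure and the boundary of $\Xi$. An open domain is an open connected nonempty set. A real function on $\Xi\subseteq\mathbb{R}^n$ is proper if the preimage (in $\Xi$) of every compact subset of $\mathbb{R}$ is compact; a function $\varphi$ on a set $\Xi\ni 0$ is positive definite if $\varphi(0)=0$ and $\varphi(\xi)>0$ for $\xi\in\Xi\setminus\{0\}$. For $x$ in the interior of the domain of a real function $\varphi$, its lower Dini derivative is $$\partial^-\varphi(x;v)=\liminf_{w\to v,\ t\to+0}\frac{\varphi(x+tw)-\varphi(x)}{t}\in[-\infty,+\infty].$$ The proximal normal cone $\mathrm{N}_{\mathrm P}(x;\Xi)$ to $\Xi$ at $x\in\Xi$ is the set of all vectors $t(z-x)$ with $t\geqslant 0$ and $z\in\mathbb{R}^n$ such that $\|z-x\|\leqslant\|z-y\|$ for all $y\in\Xi$. *Control system.* Consider $\dot x(t)=f(x(t),u(t))$, $x(0)=x_0\in G$, where the controls $u(\cdot)$ are the locally essentially bounded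 functions from $[0,+\infty)$ to $U$. Suppose that: 1. $U\subset\mathbb{R}^m$ is compact, $G,G_1\subseteq\mathbb{R}^n$ are open domains, $\bar G\subseteq G_1$, and $0\in G$; 2. $f\colon G_1\times U\to\mathbb{R}^n$ is continuous; 3. every Carathéodory solution in $G_1$ of the system on an interval $[0,T)$, $0<T\leqslant+\infty$, with $x_0\in G$ stays in $G$; 4. for every $R>0$ there is $C_{1,R}>0$ with $\|f(x,u)-f(x',u)\|\leqslant C_{1,R}\|x-x'\|$ for all $x,x'\in\bar{\mathrm{B}}_R(0)\cap\bar G$ and $u\in U$; 5. there are a continuously differentiable proper function $Y\colon G_1\to[0,+\infty)$ and a constant $C_2>0$ with $\langle \mathrm{D}Y(x),f(x,u)\rangle\leqslant C_2Y(x)$ for all $x\in G_1$, $u\in U$; 6. the set $\{f(x,u)\colon u\in U\}$ is convex for every $x\in\bar G$. *Local control Lyapunov function.* Suppose further that: 1. $\Omega\subseteq G$ is an open domain and $0\in\Omega$; 2. $V_{\mathrm{loc}}\colon\bar\Omega\to[0,+\infty)$ is continuous, proper and positive definite, and there is a continuous positive definite function $W_{\mathrm{loc}}\colon\Omega\to[0,+\infty)$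 such that $\inf_{u\in U}\partial^-V_{\mathrm{loc}}(x;f(x,u))\leqslant-W_{\mathrm{loc}}(x)$ for all $x\in\Omega$; 3. $V_{\mathrm{loc}}$ is locally Lipschitz continuous in $\Omega$; 4. $c>0$ is such that $\{x\in\bar\Omega\colon V_{\mathrm{loc}}(x)<c\}$ is an open domain in $\mathbb{R}^n$ whose closure is $\Omega_c=\{x\in\bar\Omega\colon V_{\mathrm{loc}}(x)\leqslant c\}$; there is $C_3>0$ with $\Omega_c+\mathrm{B}_{C_3}(0)\subseteq\Omega$; the boundary $\partial\Omega_c$ coincides with $l_c=\{x\in\bar\Omega\colon V_{\mathrm{loc}}(x)=c\}$ and is connected and nonempty; 5. $\lim_{\varepsilon\to+0}\sup\{\|x\|\colon x\in\bar\Omega,\ V_{\mathrm{loc}}(x)\leqslant\varepsilon\}=0$. Then there exists a constant $C_4>0$ such that, for every $x\in l_c$ and every $\nu\in\mathrm{N}_{\mathrm P}(x;\Omega_c)$ with $\|\nu\|=1$, the minimum below is attained and $$\min_{u\in U}\,\langle\nu,f(x,u)\rangle\leqslant-C_4 .$$ That is, the Petrov condition holds for the right-hand side of the system on $l_c=\partial\Omega_c$.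 -/

import Mathlib

open Set Filter Topology MeasureTheory
open scoped Pointwise

noncomputable section

namespace ExitTimeCLF

/-- An open domain: an open connected (in particular nonempty) set. -/
def IsOpenDomain {E : Type*} [TopologicalSpace E] (D : Set E) : Prop :=
  IsOpen D ∧ IsConnected D

/-- A real function on the set `D` (given as a function on the whole space, only its values on `D`
matter) is proper if the preimage in `D` of every compact set of reals is compact. -/
def IsProperOn {E : Type*} [TopologicalSpace E] (φ : E → ℝ) (D : Set E) : Prop :=
  ∀ M : Set ℝ, IsCompact M → IsCompact {x | x ∈ D ∧ φ x ∈ M}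

/-- Positive definiteness of a function on a set `D` containing the origin. -/
def IsPosDefOn {E : Type*} [Zero E] (φ : E → ℝ) (D : Set E) : Prop :=
  φ 0 = 0 ∧ ∀ x ∈ D, x ≠ 0 → 0 < φ x

/-- The lower Dini derivative (directional subderivate) of `φ` at `x` in the direction `v`,
`liminf (φ (x + t w) - φ x) / t` as `w → v` and `t → +0`, with values in `[-∞, +∞]`. -/
def lowerDini {E : Type*} [NormedAddCommGroup E] [NormedSpace ℝ E]
    (φ : E → ℝ) (x v : E) : EReal :=
  liminf (fun p : E × ℝ => (((φ (x + p.2 • p.1) - φ x) / p.2 : ℝ) : EReal)) (𝓝 v ×ˢ 𝓝[>] (0 : ℝ))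

/-- The proximal normal cone to `S` at a point `x ∈ S`: all nonnegative multiples `t • (z - x)`,
where `z` is a point of the space whose distance to `S` is attained at `x`. -/
def proximalNormalCone {E : Type*} [NormedAddCommGroup E] [InnerProductSpace ℝ E]
    (x : E) (S : Set E) : Set E :=
  {ν | ∃ z : E, ∃ t : ℝ, (∀ y ∈ S, ‖z - x‖ ≤ ‖z - y‖) ∧ 0 ≤ t ∧ ν = t • (z - x)}

/-- Admissible controls: locally essentially bounded functions from `[0, +∞)` to `U`. -/
def IsControl {F : Type*} [NormedAddCommGroup F] (U : Set F) (u : ℝ → F) : Prop :=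
  (∀ T : ℝ, MemLp u ⊤ (volume.restrict (Icc 0 T))) ∧ ∀ t : ℝ, 0 ≤ t → u t ∈ U

/-- `x` is a (Carathéodory) trajectory of `x' = f (x, u)` with `x 0 = x₀` on `[0, T)`,
`0 < T ≤ +∞`. The right-hand side is only defined for states in `G₁`. -/
structure IsTrajectory {E F : Type*} [NormedAddCommGroup E] [NormedSpace ℝ E]
    (f : E → F → E) (G₁ : Set E) (x₀ : E) (u : ℝ → F) (T : EReal) (x : ℝ → E) : Prop where
  pos : 0 < T
  mem_domain : ∀ t : ℝ, 0 ≤ t → (t : EReal) < T → x t ∈ G₁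
  integrable : ∀ t : ℝ, 0 ≤ t → (t : EReal) < T →
    IntervalIntegrable (fun s => f (x s) (u s)) volume 0 t
  eq_integral : ∀ t : ℝ, 0 ≤ t → (t : EReal) < T →
    x t = x₀ + ∫ s in (0 : ℝ)..t, f (x s) (u s)

/-- The basic conditions on the control system `x' = f (x, u)`, `x 0 ∈ G`, `u ∈ U`. -/
structure IsRegularSystem {n m : ℕ}
    (U : Set (EuclideanSpace ℝ (Fin m))) (G G₁ : Set (EuclideanSpace ℝ (Fin n)))
    (f : EuclideanSpace ℝ (Fin n) → EuclideanSpace ℝ (Fin m) → EuclideanSpace ℝ (Fin n)) :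
    Prop where
  isCompact_controls : IsCompact U
  isOpenDomain : IsOpenDomain G
  isOpenDomain' : IsOpenDomain G₁
  closure_subset : closure G ⊆ G₁
  zero_mem : 0 ∈ G
  continuousOn : ContinuousOn
    (fun p : EuclideanSpace ℝ (Fin n) × EuclideanSpace ℝ (Fin m) => f p.1 p.2) (G₁ ×ˢ U)
  /-- `G` is strongly invariant. -/
  strongly_invariant : ∀ x₀ ∈ G, ∀ u : ℝ → EuclideanSpace ℝ (Fin m), IsControl U u →
    ∀ (T : EReal) (x : ℝ → EuclideanSpace ℝ (Fin n)), IsTrajectory f G₁ x₀ u T x →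
      ∀ t : ℝ, 0 ≤ t → (t : EReal) < T → x t ∈ G
  lipschitz : ∀ R : ℝ, 0 < R → ∃ C₁ : ℝ, 0 < C₁ ∧
    ∀ x ∈ Metric.closedBall 0 R ∩ closure G, ∀ x' ∈ Metric.closedBall 0 R ∩ closure G,
      ∀ u ∈ U, ‖f x u - f x' u‖ ≤ C₁ * ‖x - x'‖
  forward_complete : ∃ (Y : EuclideanSpace ℝ (Fin n) → ℝ) (C₂ : ℝ),
    ContDiffOn ℝ 1 Y G₁ ∧ (∀ x ∈ G₁, 0 ≤ Y x) ∧ IsProperOn Y G₁ ∧ 0 < C₂ ∧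
      ∀ x ∈ G₁, ∀ u ∈ U, fderiv ℝ Y x (f x u) ≤ C₂ * Y x

/-- The sets of admissible velocities are convex. -/
def HasConvexVelocities {n m : ℕ}
    (U : Set (EuclideanSpace ℝ (Fin m))) (G : Set (EuclideanSpace ℝ (Fin n)))
    (f : EuclideanSpace ℝ (Fin n) → EuclideanSpace ℝ (Fin m) → EuclideanSpace ℝ (Fin n)) : Prop :=
  ∀ x ∈ closure G, Convex ℝ (f x '' U)

/-- The sublevel set `Ω_c` of a function `V` on the closure of `Ω`. -/
def sublevel {E : Type*} [TopologicalSpace E] (Ω : Set E) (V : E → ℝ) (c : ℝ) : Set E :=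
  {x | x ∈ closure Ω ∧ V x ≤ c}

/-- The level set `l_c` of a function `V` on the closure of `Ω`. -/
def level {E : Type*} [TopologicalSpace E] (Ω : Set E) (V : E → ℝ) (c : ℝ) : Set E :=
  {x | x ∈ closure Ω ∧ V x = c}

/-- The conditions on the local control Lyapunov function `V` on the closure of `Ω` and on the
level `c`. No smoothness of the level set is required. -/
structure IsLocalCLF {n m : ℕ}
    (U : Set (EuclideanSpace ℝ (Fin m))) (G : Set (EuclideanSpace ℝ (Fin n)))
    (f : EuclideanSpace ℝ (Fin n) → EuclideanSpace ℝ (Fin m) → EuclideanSpace ℝ (Fin n))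
    (Ω : Set (EuclideanSpace ℝ (Fin n))) (V : EuclideanSpace ℝ (Fin n) → ℝ) (c : ℝ) : Prop where
  subset : Ω ⊆ G
  isOpenDomain : IsOpenDomain Ω
  zero_mem : 0 ∈ Ω
  nonneg : ∀ x ∈ closure Ω, 0 ≤ V x
  continuousOn : ContinuousOn V (closure Ω)
  proper : IsProperOn V (closure Ω)
  posDef : IsPosDefOn V (closure Ω)
  /-- The infinitesimal decrease condition in terms of lower Dini derivatives. -/
  decrease : ∃ W : EuclideanSpace ℝ (Fin n) → ℝ,
    (∀ x ∈ Ω, 0 ≤ W x) ∧ ContinuousOn W Ω ∧ IsPosDefOn W Ω ∧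
      ∀ x ∈ Ω, (⨅ u ∈ U, lowerDini V x (f x u)) ≤ ((-W x : ℝ) : EReal)
  locallyLipschitz : LocallyLipschitzOn Ω V
  level_pos : 0 < c
  strict_sublevel_isOpenDomain : IsOpenDomain {x | x ∈ closure Ω ∧ V x < c}
  closure_strict_sublevel : closure {x | x ∈ closure Ω ∧ V x < c} = sublevel Ω V c
  thickening_subset : ∃ C₃ : ℝ, 0 < C₃ ∧ sublevel Ω V c + Metric.ball 0 C₃ ⊆ Ω
  frontier_eq : frontier (sublevel Ω V c) = level Ω V c
  level_isConnected : IsConnected (level Ω V c)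
  /-- The sublevel sets shrink to the origin. -/
  shrink : Tendsto (fun ε : ℝ => sSup ((fun x => ‖x‖) '' sublevel Ω V ε)) (𝓝[>] 0) (𝓝 0)

end ExitTimeCLF

end

/-!
Let `V` be `K`-Lipschitz near a point `x` of the level set, and let `ν` be a unit proximal normal to
the sublevel set at `x`. Moving the direction by `δ • ν` raises the lower Dini derivative by at most
`K * δ`. So if `V` decreases along `v` at a rate faster than `K * δ`, then it still decreases along
`v + δ • ν`, which is therefore tangent to the sublevel set. Proximal normals are polar to the
tangent cone, hence `⟪ν, v⟫ + δ ≤ 0`. Compactness of the level set makes both the Lipschitz constant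
and the rate of decrease, and with them `δ`, uniform.
-/

namespace ExitTimeCLF

theorem exists_uniform_lipschitzOnWith_of_isCompact {X Y : Type*} [PseudoEMetricSpace X]
    [PseudoEMetricSpace Y] {g : X → Y} {Ω S : Set X} (hg : LocallyLipschitzOn Ω g)
    (hS : IsCompact S) (hSΩ : S ⊆ Ω) :
    ∃ K, ∀ x ∈ S, ∃ s ∈ 𝓝[Ω] x, LipschitzOnWith K g s := by
  refine hS.induction_on (p := fun T => ∃ K, ∀ x ∈ T, ∃ s ∈ 𝓝[Ω] x, LipschitzOnWith K g s)
    ⟨0, fun x hx => hx.elim⟩ ?mono ?union ?nhds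
  case mono => exact fun T T' hTT' ⟨K, hK⟩ => ⟨K, fun x hx => hK x (hTT' hx)⟩
  case union =>
    rintro T T' ⟨K, hK⟩ ⟨K', hK'⟩
    refine ⟨max K K', ?_⟩
    rintro x (hx | hx)
    · obtain ⟨s, hs, hgs⟩ := hK x hx
      exact ⟨s, hs, hgs.weaken (le_max_left K K')⟩
    · obtain ⟨s, hs, hgs⟩ := hK' x hx
      exact ⟨s, hs, hgs.weaken (le_max_right K K')⟩
  case nhds =>
    intro x hx
    obtain ⟨K, s, hs, hgs⟩ := hg (hSΩ hx)
    exact ⟨{y | s ∈ 𝓝[Ω] y}, nhdsWithin_mono x hSΩ (eventually_eventually_nhdsWithin.2 hs),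
      K, fun y hy => ⟨s, hy, hgs⟩⟩

theorem eventually_snd_pos {X : Type*} (l : Filter X) :
    ∀ᶠ p : X × ℝ in l ×ˢ 𝓝[>] (0 : ℝ), 0 < p.2 :=
  tendsto_snd.eventually self_mem_nhdsWithin

section LowerDini

variable {E : Type*} [NormedAddCommGroup E] [NormedSpace ℝ E]

theorem tendsto_add_smul_nhds (x v : E) :
    Tendsto (fun p : E × ℝ => x + p.2 • p.1) (𝓝 v ×ˢ 𝓝[>] (0 : ℝ)) (𝓝 x) := by
  have hle : 𝓝 v ×ˢ 𝓝[>] (0 : ℝ) ≤ 𝓝 (v, 0) :=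
    (Filter.prod_mono le_rfl nhdsWithin_le_nhds).trans_eq nhds_prod_eq.symm
  have hcont : Continuous fun p : E × ℝ => x + p.2 • p.1 := by fun_prop
  simpa using (hcont.tendsto (v, 0)).mono_left hle

theorem lowerDini_add_le {φ : E → ℝ} {x : E} {s : Set E} {K : NNReal} (hs : s ∈ 𝓝 x)
    (hφ : LipschitzOnWith K φ s) (v w : E) :
    lowerDini φ x (v + w) ≤ ((K * ‖w‖ : ℝ) : EReal) + lowerDini φ x v := by
  let q : E × ℝ → ℝ := fun p => (φ (x + p.2 • p.1) - φ x) / p.2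
  let shift : E × ℝ → E × ℝ := Prod.map (· + w) id
  have hshift : Tendsto shift (𝓝 v ×ˢ 𝓝[>] (0 : ℝ)) (𝓝 (v + w) ×ˢ 𝓝[>] (0 : ℝ)) :=
    (tendsto_id.add_const w).prodMap tendsto_id
  have hquot : ∀ᶠ p in 𝓝 v ×ˢ 𝓝[>] (0 : ℝ), q (shift p) ≤ K * ‖w‖ + q p := by
    filter_upwards [eventually_snd_pos (𝓝 v), (tendsto_add_smul_nhds x v).eventually_mem hs,
      hshift.eventually ((tendsto_add_smul_nhds x (v + w)).eventually_mem hs)] with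
      ⟨v', t⟩ ht hv hvw
    have hdist : dist (x + t • (v' + w)) (x + t • v') = t * ‖w‖ := by
      simp [smul_add, norm_smul, abs_of_pos ht]
    have hlip : φ (x + t • (v' + w)) ≤ φ (x + t • v') + K * (t * ‖w‖) :=
      hdist ▸ hφ.le_add_mul hvw hv
    change (φ (x + t • (v' + w)) - φ x) / t ≤ K * ‖w‖ + (φ (x + t • v') - φ x) / t
    rw [← sub_le_iff_le_add, ← sub_div, div_le_iff₀ ht]
    linarith
  calc lowerDini φ x (v + w)
      ≤ liminf (fun p => (q (shift p) : EReal)) (𝓝 v ×ˢ 𝓝[>] (0 : ℝ)) :=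
        liminf_le_liminf_of_le hshift
    _ ≤ liminf ((fun _ => ((K * ‖w‖ : ℝ) : EReal)) + fun p => (q p : EReal))
          (𝓝 v ×ˢ 𝓝[>] (0 : ℝ)) :=
        liminf_le_liminf (hquot.mono fun p hp => (EReal.coe_le_coe hp).trans_eq (EReal.coe_add _ _))
    _ ≤ ((K * ‖w‖ : ℝ) : EReal) + lowerDini φ x v := by
        refine (EReal.liminf_add_le ?_ ?_).trans_eq (by rw [limsup_const]; rfl)
        · exact .inl (by rw [limsup_const]; exact EReal.coe_ne_bot _)
        · exact .inl (by rw [limsup_const]; exact EReal.coe_ne_top _)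

theorem mem_posTangentConeAt_sublevel_of_lowerDini_neg {φ : E → ℝ} {Ω : Set E} {x v : E}
    (hΩ : closure Ω ∈ 𝓝 x) (hv : lowerDini φ x v < 0) :
    v ∈ posTangentConeAt (sublevel Ω φ (φ x)) x := by
  have hzero : Tendsto (fun p : E × ℝ => p.2 • p.1) (𝓝 v ×ˢ 𝓝[>] (0 : ℝ)) (𝓝 0) := by
    simpa using tendsto_add_smul_nhds 0 v
  have hdescent : ∃ᶠ p : E × ℝ in 𝓝 v ×ˢ 𝓝[>] (0 : ℝ),
      x + p.2 • p.1 ∈ sublevel Ω φ (φ x) := by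
    refine ((frequently_lt_of_liminf_lt (h := hv)).and_eventually ((eventually_snd_pos (𝓝 v)).and
      ((tendsto_add_smul_nhds x v).eventually_mem hΩ))).mono ?_
    rintro ⟨w, t⟩ ⟨hlt, ht, hmem⟩
    have hdiff : φ (x + t • w) - φ x < 0 := by
      simpa [div_lt_iff₀ ht] using EReal.coe_lt_coe_iff.1 hlt
    exact ⟨hmem, (sub_neg.1 hdiff).le⟩
  refine mem_tangentConeAt_of_frequently _ (fun p => p.2⁻¹.toNNReal) _ hzero hdescent
    (tendsto_fst.congr' ?_)
  filter_upwards [eventually_snd_pos (𝓝 v)] with p hp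
  rw [NNReal.smul_def, Real.coe_toNNReal _ (inv_pos.2 hp).le, inv_smul_smul₀ hp.ne']

end LowerDini

section ProximalNormal

variable {E : Type*} [NormedAddCommGroup E] [InnerProductSpace ℝ E]

theorem inner_nonpos_of_mem_proximalNormalCone {S : Set E} {x ν v : E}
    (hν : ν ∈ proximalNormalCone x S) (hv : v ∈ posTangentConeAt S x) : inner ℝ ν v ≤ 0 := by
  obtain ⟨z, t, hz, ht, rfl⟩ := hν
  have hmin : IsMinOn (fun y => ‖z - y‖ ^ 2) S x := fun y hy => by
    have := hz y hy
    dsimp only [mem_ofPred_eq]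
    gcongr
  have hderiv : HasFDerivAt (fun y => ‖z - y‖ ^ 2)
      (2 • (innerSL ℝ (z - x)).comp (-ContinuousLinearMap.id ℝ E)) x :=
    ((hasFDerivAt_id x).const_sub z).norm_sq
  have hnonneg : 0 ≤ 2 * -inner ℝ (z - x) v := by
    simpa only [two_smul, two_mul, add_apply, neg_apply, ContinuousLinearMap.comp_apply,
      ContinuousLinearMap.id_apply, innerSL_apply_apply, inner_neg_right]
      using hmin.localize.hasFDerivWithinAt_nonneg hderiv.hasFDerivWithinAt hv
  rw [real_inner_smul_left]
  exact mul_nonpos_of_nonneg_of_nonpos ht (by linarith)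

theorem inner_le_neg_of_lowerDini_lt {φ : E → ℝ} {Ω s : Set E} {x v ν : E} {K : NNReal} {δ : ℝ}
    (hΩ : closure Ω ∈ 𝓝 x) (hs : s ∈ 𝓝 x) (hφ : LipschitzOnWith K φ s) (hδ : 0 ≤ δ)
    (hv : lowerDini φ x v < ((-(K * δ) : ℝ) : EReal))
    (hν : ν ∈ proximalNormalCone x (sublevel Ω φ (φ x))) (hν1 : ‖ν‖ = 1) :
    inner ℝ ν v ≤ -δ := by
  have hnorm : ‖δ • ν‖ = δ := by rw [norm_smul, hν1, mul_one, Real.norm_of_nonneg hδ]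
  have hdescent : lowerDini φ x (v + δ • ν) < 0 :=
    calc lowerDini φ x (v + δ • ν)
        ≤ ((K * δ : ℝ) : EReal) + lowerDini φ x v := by
          simpa only [hnorm] using lowerDini_add_le hs hφ v (δ • ν)
      _ < ((K * δ : ℝ) : EReal) + ((-(K * δ) : ℝ) : EReal) := EReal.add_lt_add_left_coe hv _
      _ = 0 := by rw [← EReal.coe_add, add_neg_cancel, EReal.coe_zero]
  have hinner : inner ℝ ν (v + δ • ν) ≤ 0 := inner_nonpos_of_mem_proximalNormalCone hν
    (mem_posTangentConeAt_sublevel_of_lowerDini_neg hΩ hdescent)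
  rw [inner_add_right, real_inner_smul_right, real_inner_self_eq_norm_sq, hν1] at hinner
  linarith

end ProximalNormal

section ControlSystem

variable {n m : ℕ} {U : Set (EuclideanSpace ℝ (Fin m))} {G G₁ Ω : Set (EuclideanSpace ℝ (Fin n))}
  {f : EuclideanSpace ℝ (Fin n) → EuclideanSpace ℝ (Fin m) → EuclideanSpace ℝ (Fin n)}
  {V : EuclideanSpace ℝ (Fin n) → ℝ} {c : ℝ}

theorem IsRegularSystem.continuousOn_control (hsys : IsRegularSystem U G G₁ f)
    {x : EuclideanSpace ℝ (Fin n)} (hx : x ∈ G₁) : ContinuousOn (f x) U :=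
  hsys.continuousOn.comp (f := fun u => (x, u)) (by fun_prop) fun _ hu => ⟨hx, hu⟩

theorem IsLocalCLF.isCompact_level (hV : IsLocalCLF U G f Ω V c) : IsCompact (level Ω V c) :=
  hV.proper {c} isCompact_singleton

theorem IsLocalCLF.level_subset (hV : IsLocalCLF U G f Ω V c) : level Ω V c ⊆ Ω := by
  obtain ⟨C₃, hC₃, hsub⟩ := hV.thickening_subset
  intro x hx
  have hmem : x + 0 ∈ sublevel Ω V c + Metric.ball 0 C₃ :=
    add_mem_add ⟨hx.1, hx.2.le⟩ (Metric.mem_ball_self hC₃)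
  exact hsub (by rwa [add_zero] at hmem)

theorem IsLocalCLF.ne_zero_of_mem_level (hV : IsLocalCLF U G f Ω V c)
    {x : EuclideanSpace ℝ (Fin n)} (hx : x ∈ level Ω V c) : x ≠ 0 := by
  rintro rfl
  exact hV.level_pos.ne (hV.posDef.1.symm.trans hx.2)

end ControlSystem

end ExitTimeCLF

open ExitTimeCLF in
theorem proposition2p11_general {E F : Type*} [NormedAddCommGroup E] [InnerProductSpace ℝ E]
    [TopologicalSpace F] {U : Set F} {f : E → F → E} {Ω : Set E} {V W : E → ℝ} {c : ℝ}
    (hU : IsCompact U) (hf : ∀ x ∈ level Ω V c, ContinuousOn (f x) U) (hΩ : IsOpen Ω)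
    (hcompact : IsCompact (level Ω V c)) (hsub : level Ω V c ⊆ Ω) (hV : LocallyLipschitzOn Ω V)
    (hW : ContinuousOn W (level Ω V c)) (hWpos : ∀ x ∈ level Ω V c, 0 < W x)
    (hdecrease : ∀ x ∈ level Ω V c, (⨅ u ∈ U, lowerDini V x (f x u)) ≤ ((-W x : ℝ) : EReal)) :
    ∃ C₄ : ℝ, 0 < C₄ ∧
      ∀ x ∈ level Ω V c, ∀ ν ∈ proximalNormalCone x (sublevel Ω V c), ‖ν‖ = 1 →
        ∃ u₀ ∈ U, IsMinOn (fun u => inner ℝ ν (f x u)) U u₀ ∧ inner ℝ ν (f x u₀) ≤ -C₄ := by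
  obtain ⟨w, hw, hwW⟩ := hcompact.exists_forall_le' hW hWpos
  obtain ⟨K, hK⟩ := exists_uniform_lipschitzOnWith_of_isCompact hV hcompact hsub
  obtain ⟨δ, hδ, hKδ⟩ : ∃ δ : ℝ, 0 < δ ∧ K * δ < w := exists_pos_mul_lt hw K
  refine ⟨δ, hδ, fun x hx ν hν hν1 => ?_⟩
  have hΩx : Ω ∈ 𝓝 x := hΩ.mem_nhds (hsub hx)
  obtain ⟨s, hs, hVs⟩ := hK x hx
  rw [hΩ.nhdsWithin_eq (hsub hx)] at hs
  obtain ⟨u, hu, hdini⟩ : ∃ u ∈ U, lowerDini V x (f x u) < ((-(K * δ) : ℝ) : EReal) := by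
    have hlt : ((-W x : ℝ) : EReal) < ((-(K * δ) : ℝ) : EReal) :=
      EReal.coe_lt_coe_iff.2 (neg_lt_neg (hKδ.trans_le (hwW x hx)))
    simpa only [iInf_lt_iff, exists_prop] using (hdecrease x hx).trans_lt hlt
  have hle : inner ℝ ν (f x u) ≤ -δ :=
    inner_le_neg_of_lowerDini_lt (mem_of_superset hΩx subset_closure) hs hVs hδ.le hdini
      (by rwa [hx.2]) hν1
  obtain ⟨u₀, hu₀, hmin⟩ := hU.exists_isMinOn ⟨u, hu⟩
    (f := fun u => inner ℝ ν (f x u)) (continuousOn_const.inner (hf x hx))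
  exact ⟨u₀, hu₀, hmin, (hmin hu).trans hle⟩

theorem proposition2p11 {n m : ℕ}
    (U : Set (EuclideanSpace ℝ (Fin m))) (G G₁ : Set (EuclideanSpace ℝ (Fin n)))
    (f : EuclideanSpace ℝ (Fin n) → EuclideanSpace ℝ (Fin m) → EuclideanSpace ℝ (Fin n))
    (hsys : ExitTimeCLF.IsRegularSystem U G G₁ f)
    (hconv : ExitTimeCLF.HasConvexVelocities U G f)
    (Ω : Set (EuclideanSpace ℝ (Fin n))) (Vloc : EuclideanSpace ℝ (Fin n) → ℝ) (c : ℝ)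
    (hV : ExitTimeCLF.IsLocalCLF U G f Ω Vloc c) :
    ∃ C₄ : ℝ, 0 < C₄ ∧
      ∀ x ∈ ExitTimeCLF.level Ω Vloc c,
        ∀ ν ∈ ExitTimeCLF.proximalNormalCone x (ExitTimeCLF.sublevel Ω Vloc c), ‖ν‖ = 1 →
          ∃ u₀ ∈ U, IsMinOn (fun u => inner ℝ ν (f x u)) U u₀ ∧ inner ℝ ν (f x u₀) ≤ -C₄ := by
  obtain ⟨W, -, hW, hWpos, hdecrease⟩ := hV.decrease
  have hsub := hV.level_subset
  exact proposition2p11_general hsys.isCompact_controls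
    (fun x hx => hsys.continuousOn_control (hsys.closure_subset (subset_closure
      (hV.subset (hsub hx))))) hV.isOpenDomain.1 hV.isCompact_level hsub
    hV.locallyLipschitz (hW.mono hsub)
    (fun x hx => hWpos.2 x (hsub hx) (hV.ne_zero_of_mem_level hx)) fun x hx => hdecrease x (hsub hx)
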